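/- Fix an integer $r \ge 3$ and a real constant $\lambda > 0$. For each $n$, let the elements of $[n] = \{1, \dots, n\}$ be colored independently and uniformly at random with $c_n$ colors, where $c_n$ is a positive integer and $c_n = (1+o(1))\, \lambda\, n^{2/(r-1)}$ as $n \to \infty$ (for instance, $\lambda n^{2/(r-1)}$ rounded to an integer). Let $W_r([n])$ be the number of monochromatic $r$-term arithmetic progressions in $[n]$, that is, the number of sets $\{a, a+d, \dots, a+(r-1)d\} \subseteq [n]$ with $d \ge 1$ all of whose elements have the same color. Then, as $n \to \infty$, $W_r([n])$ converges in distribution to the Poisson distribution with mean $$\frac{1}{2(r-1)\lambda^{r-1}}.$$ -/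

import Mathlib

open MeasureTheory ProbabilityTheory Filter Topology

/-- The finite set `e` of natural numbers is an `r`-term arithmetic progression
`{a, a + d, …, a + (r - 1) d}` with common difference `d ≥ 1`. Progressions are regarded as sets,
so that a progression and its reversal are the same object. -/
def IsArithProg (r : ℕ) (e : Finset ℕ) : Prop :=
  ∃ a d : ℕ, 0 < d ∧ e = (Finset.range r).image (fun i => a + i * d)

/-- The hyperedges of the `r`-uniform hypergraph with vertex set `A` whose hyperedges are the
`r`-term arithmetic progressions contained in `A`. -/
noncomputable def apHyperedges (r : ℕ) (A : Finset ℕ) : Finset (Finset ℕ) :=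
  open Classical in A.powerset.filter (IsArithProg r)

/-- All vertices of `e` receive the same color under the coloring `x`. -/
def IsMonochromatic (x : ℕ → ℕ) (e : Finset ℕ) : Prop :=
  ∀ v ∈ e, ∀ v' ∈ e, x v = x v'

/-- The number of monochromatic `r`-term arithmetic progressions in `A` under the coloring `x`
(which only depends on the colors `x v` with `v ∈ A`). -/
noncomputable def monoAPCount (r : ℕ) (A : Finset ℕ) (x : ℕ → ℕ) : ℕ :=
  open Classical in ((apHyperedges r A).filter (IsMonochromatic x)).card

/-- `X v`, for `v ∈ A`, are independent random colors, each uniformly distributed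
on `{1, …, c}`. (For `v ∉ A` the values `X v` are irrelevant.) -/
structure IsUniformColoring {Ω : Type*} [MeasurableSpace Ω] (P : Measure Ω)
    (A : Finset ℕ) (c : ℕ) (X : ℕ → Ω → ℕ) : Prop where
  measurable : ∀ v ∈ A, Measurable (X v)
  indep : iIndepFun (fun (v : A) => X v) P
  uniform : ∀ v ∈ A, ∀ a ∈ Finset.Icc 1 c, P {ω | X v ω = a} = (c : ENNReal)⁻¹

/-! Let `W` count locally dependent events `E i` of probabilities `p i`, with total mean `a`, and
let `φ` be its characteristic function. Then `φ' u` is `I` times the sum of the expectations of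
`1_{E i} * exp (I u W)`. If `E i` is independent of the events outside its neighborhood, each
expectation is close to `p i * exp (I u) * φ u`. Hence `φ` almost solves `φ' = I a exp (I u) φ`, the
equation of the Poisson characteristic function. An integrating factor turns this into a bound by
`dependencySum` (`norm_integral_cexp_eventCount_sub_le`).

For progressions, the mean is about `n ^ 2 / (2 (r - 1)) * c ^ (1 - r)`, and `n ^ 2 * c ^ (1 - r)`
tends to `lam ^ (1 - r)`. Two progressions are neighbors when they meet. A progression meets `O(n)`
others, contributing `O(n ^ 3 * c ^ (-2 (r - 1))) = O(1 / n)` in total, except that pairs sharing at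
least two points are likelier. Each progression has at most `r ^ 4` such partners, so these pairs
contribute `O(n ^ 2 * c ^ (-r)) = O(1 / c)`. Both errors vanish
(`IsUniformColoring.dependencySum_le`). -/

/-- A bounded random variable has a differentiable characteristic function. -/
lemma hasDerivAt_integral_cexp_of_bounded {Ω : Type*} [MeasurableSpace Ω] {P : Measure Ω}
    [IsProbabilityMeasure P] {W : Ω → ℝ} (hW : Measurable W) {K : ℝ} (hK : ∀ ω, |W ω| ≤ K)
    (t : ℝ) :
    HasDerivAt (fun s : ℝ => ∫ ω, Complex.exp (s * W ω * Complex.I) ∂P)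
      (∫ ω, (W ω * Complex.I) * Complex.exp (t * W ω * Complex.I) ∂P) t := by
  have hnorm : ∀ (s : ℝ) ω, ‖Complex.exp (s * W ω * Complex.I)‖ = 1 := fun s ω => by
    rw [← Complex.ofReal_mul, Complex.norm_exp_ofReal_mul_I]
  refine (hasDerivAt_integral_of_dominated_loc_of_deriv_le
    (F := fun (s : ℝ) ω => Complex.exp (s * W ω * Complex.I))
    (F' := fun (s : ℝ) ω => (W ω * Complex.I) * Complex.exp (s * W ω * Complex.I))
    (bound := fun _ => K) (s := Set.univ) univ_mem ?_ ?_ ?_ ?_ ?_ ?_).2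
  · exact Eventually.of_forall fun s => by fun_prop
  · exact Integrable.of_bound (by fun_prop) 1 (ae_of_all _ fun ω => (hnorm t ω).le)
  · fun_prop
  · refine ae_of_all _ fun ω s _ => ?_
    rw [norm_mul, hnorm, norm_mul, Complex.norm_I, Complex.norm_real]
    simpa using hK ω
  · exact integrable_const K
  · refine ae_of_all _ fun ω s _ => ?_
    have h : HasDerivAt (fun s : ℝ => (s : ℂ) * W ω * Complex.I) (W ω * Complex.I) s := by
      simpa [mul_assoc] using (Complex.ofRealCLM.hasDerivAt (x := s)).mul_const (W ω * Complex.I)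
    simpa [mul_comm] using h.cexp

/-- The function `x ↦ exp (i t x)` is Lipschitz with constant `|t|`. -/
lemma norm_cexp_add_sub_le (t x z : ℝ) (hz : 0 ≤ z) :
    ‖Complex.exp (t * (x + z : ℝ) * Complex.I) - Complex.exp (t * x * Complex.I)‖ ≤ |t| * z := by
  have h : Complex.exp (t * (x + z : ℝ) * Complex.I) - Complex.exp (t * x * Complex.I)
      = Complex.exp ((t * x : ℝ) * Complex.I) * (Complex.exp (Complex.I * (t * z : ℝ)) - 1) := by
    rw [mul_sub, ← Complex.exp_add]
    push_cast
    ring_nf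
  rw [h, norm_mul, Complex.norm_exp_ofReal_mul_I, one_mul]
  refine Real.norm_exp_I_mul_ofReal_sub_one_le.trans ?_
  rw [Real.norm_eq_abs, abs_mul, abs_of_nonneg hz]

/-! ### Poisson approximation under local dependence -/

section LocalDependence

variable {Ω ι : Type*} [MeasurableSpace Ω]

/-- The number of events `E i`, `i ∈ s`, that occur. -/
noncomputable def eventCount (s : Finset ι) (E : ι → Set Ω) (ω : Ω) : ℝ :=
  ∑ i ∈ s, (E i).indicator (fun _ => (1 : ℝ)) ω

lemma measurable_eventCount {s : Finset ι} {E : ι → Set Ω} (hE : ∀ i ∈ s, MeasurableSet (E i)) :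
    Measurable (eventCount s E) :=
  Finset.measurable_sum s fun i hi => measurable_const.indicator (hE i hi)

omit [MeasurableSpace Ω] in
lemma eventCount_nonneg (s : Finset ι) (E : ι → Set Ω) (ω : Ω) : 0 ≤ eventCount s E ω :=
  Finset.sum_nonneg fun _ _ => Set.indicator_nonneg (fun _ _ => zero_le_one) ω

omit [MeasurableSpace Ω] in
lemma abs_eventCount_le (s : Finset ι) (E : ι → Set Ω) (ω : Ω) :
    |eventCount s E ω| ≤ s.card := by
  rw [abs_of_nonneg (eventCount_nonneg s E ω)]
  refine (Finset.sum_le_card_nsmul s _ 1 fun _ _ => ?_).trans (by simp)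
  exact Set.indicator_le_self' (fun _ _ => zero_le_one) ω

variable {P : Measure Ω} [IsProbabilityMeasure P]

lemma integral_eventCount {s : Finset ι} {E : ι → Set Ω} (hE : ∀ i ∈ s, MeasurableSet (E i)) :
    ∫ ω, eventCount s E ω ∂P = ∑ i ∈ s, P.real (E i) := by
  unfold eventCount
  rw [integral_finsetSum s fun i hi => (integrable_const 1).indicator (hE i hi)]
  exact Finset.sum_congr rfl fun i hi => integral_indicator_one (hE i hi)

lemma integrable_eventCount {s : Finset ι} {E : ι → Set Ω} (hE : ∀ i ∈ s, MeasurableSet (E i)) :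
    Integrable (eventCount s E) P :=
  integrable_finsetSum s fun i hi => (integrable_const 1).indicator (hE i hi)

/-- If the event `E i` is independent of the count of the events outside the neighborhood `N` of
`i`, then conditioning on `E i` shifts the characteristic function of the total count by one,
up to a small error. -/
lemma norm_integral_indicator_mul_cexp_sub_le [DecidableEq ι] {s N : Finset ι} {E : ι → Set Ω}
    (hE : ∀ i ∈ s, MeasurableSet (E i)) {i : ι} (hNs : N ⊆ s) (hiN : i ∈ N)
    (hind : IndepFun ((E i).indicator fun _ => (1 : ℝ)) (eventCount (s \ N) E) P) (t : ℝ) :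
    ‖∫ ω, (((E i).indicator (fun _ => (1 : ℝ)) ω : ℝ) : ℂ)
          * Complex.exp (t * eventCount s E ω * Complex.I) ∂P
        - Complex.exp (t * Complex.I) * P.real (E i)
          * ∫ ω, Complex.exp (t * eventCount s E ω * Complex.I) ∂P‖
      ≤ |t| * (∑ j ∈ N.erase i, P.real (E i ∩ E j) + P.real (E i) * ∑ j ∈ N, P.real (E j)) := by
  have hEi := hE i (hNs hiN)
  have hEN : ∀ j ∈ N, MeasurableSet (E j) := fun j hj => hE j (hNs hj)
  have hEe : ∀ j ∈ N.erase i, MeasurableSet (E j) := fun j hj => hEN j (Finset.mem_of_mem_erase hj)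
  set J : Ω → ℝ := (E i).indicator fun _ => (1 : ℝ) with hJ
  have hJm : Measurable J := measurable_const.indicator hEi
  set W := eventCount s E with hW
  set V := eventCount (s \ N) E with hV
  have hWm : Measurable W := measurable_eventCount hE
  have hVm : Measurable V :=
    measurable_eventCount fun j hj => hE j (Finset.mem_sdiff.1 hj).1
  have hsplit : ∀ ω, W ω = V ω + eventCount N E ω := fun ω =>
    (Finset.sum_sdiff hNs).symm
  have hsplit' : ∀ ω, eventCount N E ω = eventCount (N.erase i) E ω + J ω := fun ω =>
    (Finset.sum_erase_add N _ hiN).symm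
  have hexp : ∀ {Z : Ω → ℝ}, Measurable Z →
      Integrable (fun ω => Complex.exp (t * Z ω * Complex.I)) P := fun {Z} hZ =>
    Integrable.of_bound (by fun_prop) 1 (ae_of_all _ fun ω => by
      rw [← Complex.ofReal_mul, Complex.norm_exp_ofReal_mul_I])
  have hJ01 : ∀ ω, J ω = 0 ∨ J ω = 1 := fun ω => by
    by_cases h : ω ∈ E i <;> simp [hJ, h]
  have hJexp : ∀ {Z : Ω → ℝ}, Measurable Z →
      Integrable (fun ω => (J ω : ℂ) * Complex.exp (t * Z ω * Complex.I)) P := fun {Z} hZ =>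
    Integrable.of_bound (by fun_prop) 1 (ae_of_all _ fun ω => by
      rw [norm_mul, ← Complex.ofReal_mul, Complex.norm_exp_ofReal_mul_I, Complex.norm_real]
      rcases hJ01 ω with h | h <;> simp [h])
  -- Main term: `V` omits all of `N`, so it is independent of `J`; the `+ 1` is the contribution of
  -- `E i` itself.
  have hfac : ∫ ω, (J ω : ℂ) * Complex.exp (t * (V ω + 1 : ℝ) * Complex.I) ∂P
      = Complex.exp (t * Complex.I) * P.real (E i)
        * ∫ ω, Complex.exp (t * V ω * Complex.I) ∂P := by
    have h1 := hind.integral_fun_comp_mul_comp (f := fun x : ℝ => (x : ℂ))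
      (g := fun x : ℝ => Complex.exp (t * (x + 1 : ℝ) * Complex.I)) hJm.aemeasurable
      hVm.aemeasurable (by fun_prop) (by fun_prop)
    rw [h1, integral_complex_ofReal, hJ, integral_indicator_const _ hEi, ← integral_const_mul,
      ← integral_const_mul]
    congr 1 with ω
    push_cast
    rw [mul_add, mul_one, add_mul, Complex.exp_add]
    simp
    ring
  -- On `E i`, `W` exceeds `V + 1` by the number of other neighbors that occur, which gives the
  -- joint probabilities.
  have hA : ‖∫ ω, (J ω : ℂ) * Complex.exp (t * W ω * Complex.I) ∂P
      - ∫ ω, (J ω : ℂ) * Complex.exp (t * (V ω + 1 : ℝ) * Complex.I) ∂P‖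
      ≤ |t| * ∑ j ∈ N.erase i, P.real (E i ∩ E j) := by
    have hint : ∫ ω, |t| * eventCount (N.erase i) (fun j => E i ∩ E j) ω ∂P
        = |t| * ∑ j ∈ N.erase i, P.real (E i ∩ E j) := by
      rw [integral_const_mul, integral_eventCount fun j hj => hEi.inter (hEe j hj)]
    rw [← integral_sub (hJexp hWm) (hJexp (hVm.add_const 1)), ← hint]
    refine norm_integral_le_of_norm_le
      ((integrable_eventCount fun j hj => hEi.inter (hEe j hj)).const_mul _)
      (ae_of_all _ fun ω => ?_)
    rw [← mul_sub, norm_mul, Complex.norm_real]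
    by_cases h : ω ∈ E i
    · have hJ1 : J ω = 1 := by simp [hJ, h]
      have hcount : eventCount (N.erase i) (fun j => E i ∩ E j) ω
          = eventCount (N.erase i) E ω :=
        Finset.sum_congr rfl fun j _ => by by_cases h' : ω ∈ E j <;> simp [h, h']
      have hWω : W ω = (V ω + 1) + eventCount (N.erase i) E ω := by
        rw [hsplit, hsplit', hJ1]; ring
      rw [hJ1, hWω, hcount, norm_one, one_mul]
      exact norm_cexp_add_sub_le _ _ _ (eventCount_nonneg _ _ _)
    · have hJ0 : J ω = 0 := by simp [hJ, h]
      rw [hJ0, norm_zero, zero_mul]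
      exact mul_nonneg (abs_nonneg _) (eventCount_nonneg _ _ _)
  -- Returning from `V` to `W` costs the expected count over all of `N`; the factor `p` multiplies
  -- it below.
  have hB : ‖∫ ω, Complex.exp (t * W ω * Complex.I) ∂P
      - ∫ ω, Complex.exp (t * V ω * Complex.I) ∂P‖ ≤ |t| * ∑ j ∈ N, P.real (E j) := by
    rw [← integral_sub (hexp hWm) (hexp hVm), ← integral_eventCount hEN, ← integral_const_mul]
    refine norm_integral_le_of_norm_le ((integrable_eventCount hEN).const_mul _)
      (ae_of_all _ fun ω => ?_)
    rw [hsplit]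
    exact norm_cexp_add_sub_le _ _ _ (eventCount_nonneg _ _ _)
  rw [hfac] at hA
  set p := P.real (E i)
  have hp : ‖Complex.exp (t * Complex.I) * (p : ℂ)‖ = p := by
    rw [norm_mul, Complex.norm_exp_ofReal_mul_I, one_mul, Complex.norm_real,
      Real.norm_of_nonneg measureReal_nonneg]
  calc _ = ‖(∫ ω, (J ω : ℂ) * Complex.exp (t * W ω * Complex.I) ∂P
          - Complex.exp (t * Complex.I) * p * ∫ ω, Complex.exp (t * V ω * Complex.I) ∂P)
        - Complex.exp (t * Complex.I) * p * (∫ ω, Complex.exp (t * W ω * Complex.I) ∂P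
          - ∫ ω, Complex.exp (t * V ω * Complex.I) ∂P)‖ := by congr 1; ring
    _ ≤ |t| * ∑ j ∈ N.erase i, P.real (E i ∩ E j) + p * (|t| * ∑ j ∈ N, P.real (E j)) := by
      refine (norm_sub_le _ _).trans (add_le_add hA ?_)
      rw [norm_mul, hp]
      exact mul_le_mul_of_nonneg_left hB measureReal_nonneg
    _ = _ := by ring

/-- The quantity that controls the distance between a count of locally dependent events and the
Poisson distribution, where `N i` is the dependency neighborhood of the event `E i`. -/
noncomputable def dependencySum [DecidableEq ι] (P : Measure Ω) (s : Finset ι) (N : ι → Finset ι)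
    (E : ι → Set Ω) : ℝ :=
  ∑ i ∈ s, (∑ j ∈ (N i).erase i, P.real (E i ∩ E j) + P.real (E i) * ∑ j ∈ N i, P.real (E j))

omit [IsProbabilityMeasure P] in
lemma dependencySum_nonneg [DecidableEq ι] (s : Finset ι) (N : ι → Finset ι) (E : ι → Set Ω) :
    0 ≤ dependencySum P s N E := by
  unfold dependencySum
  positivity

/-- Since `|exp (I t) - 1| ≤ 2`, this controls both the integrating factor and its inverse. -/
lemma norm_cexp_mul_cexp_sub_one_le (a t : ℝ) :
    ‖Complex.exp (a * (Complex.exp (t * Complex.I) - 1))‖ ≤ Real.exp (2 * |a|) := by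
  refine (Complex.norm_exp_le_exp_norm _).trans (Real.exp_le_exp.2 ?_)
  rw [norm_mul, Complex.norm_real, Real.norm_eq_abs, mul_comm]
  refine mul_le_mul_of_nonneg_right ((norm_sub_le _ _).trans ?_) (abs_nonneg a)
  rw [Complex.norm_exp_ofReal_mul_I, norm_one]
  norm_num

/-- Poisson approximation of a count of locally dependent events, at the level of characteristic
functions. -/
theorem norm_integral_cexp_eventCount_sub_le [DecidableEq ι] {s : Finset ι}
    {N : ι → Finset ι} {E : ι → Set Ω}
    (hE : ∀ i ∈ s, MeasurableSet (E i)) (hNs : ∀ i ∈ s, N i ⊆ s) (hiN : ∀ i ∈ s, i ∈ N i)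
    (hind : ∀ i ∈ s,
      IndepFun ((E i).indicator fun _ => (1 : ℝ)) (eventCount (s \ N i) E) P) (t : ℝ) :
    ‖∫ ω, Complex.exp (t * eventCount s E ω * Complex.I) ∂P
        - Complex.exp ((∑ i ∈ s, P.real (E i) : ℝ) * (Complex.exp (t * Complex.I) - 1))‖
      ≤ t ^ 2 * Real.exp (4 * |∑ i ∈ s, P.real (E i)|) * dependencySum P s N E := by
  set W := eventCount s E with hW
  have hWm : Measurable W := measurable_eventCount hE
  set a : ℝ := ∑ i ∈ s, P.real (E i) with ha
  set B := dependencySum P s N E with hB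
  have hB0 : 0 ≤ B := dependencySum_nonneg s N E
  set φ : ℝ → ℂ := fun u => ∫ ω, Complex.exp (u * W ω * Complex.I) ∂P with hφ
  set φ' : ℝ → ℂ := fun u => ∫ ω, (W ω * Complex.I) * Complex.exp (u * W ω * Complex.I) ∂P with hφ'
  have hφd : ∀ u, HasDerivAt φ (φ' u) u := fun u =>
    hasDerivAt_integral_cexp_of_bounded hWm (abs_eventCount_le s E) u
  have hstein : ∀ u, ‖φ' u - Complex.I * a * Complex.exp (u * Complex.I) * φ u‖ ≤ |u| * B := by
    intro u
    have h1 : φ' u = Complex.I * ∑ i ∈ s, ∫ ω, (((E i).indicator (fun _ => (1 : ℝ)) ω : ℝ) : ℂ)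
        * Complex.exp (u * W ω * Complex.I) ∂P := by
      rw [← integral_finsetSum, ← integral_const_mul]
      · refine integral_congr_ae (ae_of_all _ fun ω => ?_)
        simp only [hW, eventCount]
        push_cast
        rw [← Finset.sum_mul]
        ring
      · intro i hi
        refine Integrable.of_bound (C := 1) ?_ (ae_of_all _ fun ω => ?_)
        · have : Measurable ((E i).indicator fun _ => (1 : ℝ)) :=
            measurable_const.indicator (hE i hi)
          fun_prop
        · rw [norm_mul, ← Complex.ofReal_mul, Complex.norm_exp_ofReal_mul_I, Complex.norm_real]
          by_cases h : ω ∈ E i <;> simp [h]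
    have h2 : φ' u - Complex.I * a * Complex.exp (u * Complex.I) * φ u
        = Complex.I * ∑ i ∈ s, (∫ ω, (((E i).indicator (fun _ => (1 : ℝ)) ω : ℝ) : ℂ)
            * Complex.exp (u * W ω * Complex.I) ∂P
          - Complex.exp (u * Complex.I) * P.real (E i) * φ u) := by
      rw [h1, Finset.sum_sub_distrib, ← Finset.sum_mul, ← Finset.mul_sum, ha]
      push_cast
      ring
    rw [h2, norm_mul, Complex.norm_I, one_mul, hB, dependencySum, Finset.mul_sum]
    refine (norm_sum_le _ _).trans (Finset.sum_le_sum fun i hi => ?_)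
    exact norm_integral_indicator_mul_cexp_sub_le hE (hNs i hi) (hiN i hi) (hind i hi) u
  -- Integrating factor: the derivative of `φ * g` is the defect in `hstein` times `g`.
  set g : ℝ → ℂ := fun u => Complex.exp ((-a : ℝ) * (Complex.exp (u * Complex.I) - 1)) with hg
  have hgd : ∀ u, HasDerivAt g
      (g u * ((-a : ℝ) * (Complex.exp (u * Complex.I) * Complex.I))) u := by
    intro u
    have h : HasDerivAt (fun u : ℝ => (u : ℂ) * Complex.I) Complex.I u := by
      simpa using (Complex.ofRealCLM.hasDerivAt (x := u)).mul_const Complex.I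
    exact ((h.cexp.sub_const 1).const_mul _).cexp
  have hbound : ‖φ t * g t - φ 0 * g 0‖
      ≤ (|t| * B * Real.exp (2 * |a|)) * ‖t - 0‖ := by
    refine Convex.norm_image_sub_le_of_norm_hasDerivWithin_le (s := Set.uIcc 0 t)
      (f := fun u => φ u * g u)
      (fun u _ => ((hφd u).mul (hgd u)).hasDerivWithinAt) ?_ (convex_uIcc 0 t)
      Set.left_mem_uIcc Set.right_mem_uIcc
    intro u hu
    have hut : |u| ≤ |t| := by
      simpa using Set.abs_sub_left_of_mem_uIcc hu
    have h : φ' u * g u + φ u * (g u * ((-a : ℝ) * (Complex.exp (u * Complex.I) * Complex.I)))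
        = (φ' u - Complex.I * a * Complex.exp (u * Complex.I) * φ u) * g u := by
      push_cast
      ring
    rw [h, norm_mul]
    have hgn : ‖g u‖ ≤ Real.exp (2 * |a|) := by
      simpa only [abs_neg] using norm_cexp_mul_cexp_sub_one_le (-a) u
    refine mul_le_mul ((hstein u).trans ?_) hgn (norm_nonneg _) (by positivity)
    exact mul_le_mul_of_nonneg_right hut hB0
  have h0 : φ 0 * g 0 = 1 := by simp [hφ, hg]
  rw [h0, sub_zero, Real.norm_eq_abs] at hbound
  have hfin : φ t - Complex.exp (a * (Complex.exp (t * Complex.I) - 1))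
      = (φ t * g t - 1) * Complex.exp (a * (Complex.exp (t * Complex.I) - 1)) := by
    rw [sub_mul, one_mul, mul_assoc, hg, ← Complex.exp_add]
    push_cast
    rw [neg_mul, neg_add_cancel, Complex.exp_zero, mul_one]
  rw [hfin, norm_mul]
  -- One `|t|` bounds the defect, the other is the interval length; the two exponentials bound `g`
  -- and its inverse.
  calc _ ≤ (|t| * B * Real.exp (2 * |a|)) * |t| * Real.exp (2 * |a|) :=
        mul_le_mul hbound (norm_cexp_mul_cexp_sub_one_le a t) (norm_nonneg _) (by positivity)
    _ = |t| ^ 2 * (Real.exp (2 * |a|) * Real.exp (2 * |a|)) * B := by ring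
    _ = _ := by rw [sq_abs, ← Real.exp_add]; ring_nf

end LocalDependence

/-- A Poisson limit theorem for counts of locally dependent events. -/
theorem tendstoInDistribution_poisson_of_dependencySum {ι : Type*} [DecidableEq ι] {Ω : ℕ → Type*}
    [∀ n, MeasurableSpace (Ω n)] {P : ∀ n, Measure (Ω n)} [∀ n, IsProbabilityMeasure (P n)]
    {s : ℕ → Finset ι} {N : ℕ → ι → Finset ι} {E : ∀ n, ι → Set (Ω n)}
    (hE : ∀ n, ∀ i ∈ s n, MeasurableSet (E n i)) (hNs : ∀ n, ∀ i ∈ s n, N n i ⊆ s n)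
    (hiN : ∀ n, ∀ i ∈ s n, i ∈ N n i)
    (hind : ∀ n, ∀ i ∈ s n,
      IndepFun ((E n i).indicator fun _ => (1 : ℝ)) (eventCount (s n \ N n i) (E n)) (P n))
    {a : ℝ} (ha : 0 ≤ a) (hmean : Tendsto (fun n => ∑ i ∈ s n, (P n).real (E n i)) atTop (𝓝 a))
    (hdep : Tendsto (fun n => dependencySum (P n) (s n) (N n) (E n)) atTop (𝓝 0)) :
    TendstoInDistribution (fun n => eventCount (s n) (E n)) atTop (fun k : ℕ => (k : ℝ)) P
      (poissonMeasure a.toNNReal) where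
  forall_aemeasurable n := (measurable_eventCount (hE n)).aemeasurable
  tendsto := by
    refine ProbabilityMeasure.tendsto_of_tendsto_charFun fun t => ?_
    simp only [ProbabilityMeasure.coe_mk]
    rw [show (poissonMeasure a.toNNReal).map (fun k : ℕ => (k : ℝ))
      = (poissonMeasure a.toNNReal).map (Nat.cast : ℕ → ℝ) from rfl,
      charFun_map_cast_poissonMeasure]
    have hchar : ∀ n, charFun ((P n).map (eventCount (s n) (E n))) t
        = ∫ ω, Complex.exp (t * eventCount (s n) (E n) ω * Complex.I) ∂(P n) := fun n => by
      rw [charFun_apply_real, integral_map (measurable_eventCount (hE n)).aemeasurable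
        (by fun_prop)]
    simp_rw [hchar]
    have h1 : Tendsto (fun n => Complex.exp ((∑ i ∈ s n, (P n).real (E n i) : ℝ)
        * (Complex.exp (t * Complex.I) - 1))) atTop
        (𝓝 (Complex.exp ((a.toNNReal : ℝ) * (Complex.exp (t * Complex.I) - 1)))) := by
      rw [Real.coe_toNNReal a ha]
      exact (((Complex.continuous_ofReal.tendsto a).comp hmean).mul_const _).cexp
    have h2 : Tendsto (fun n => t ^ 2 * Real.exp (4 * |∑ i ∈ s n, (P n).real (E n i)|)
        * dependencySum (P n) (s n) (N n) (E n)) atTop (𝓝 0) := by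
      simpa using (((Real.continuous_exp.tendsto _).comp
        (hmean.abs.const_mul 4)).const_mul (t ^ 2)).mul hdep
    have h3 := squeeze_zero_norm (fun n =>
      norm_integral_cexp_eventCount_sub_le (hE n) (hNs n) (hiN n) (hind n) t) h2
    simpa using h3.add h1

/-! ### Counting arithmetic progressions -/

/-- The arithmetic progression `{a, a + d, …, a + (r - 1) d}`. -/
def arithProg (r a d : ℕ) : Finset ℕ := (Finset.range r).image fun i => a + i * d

lemma mem_arithProg {r a d v : ℕ} : v ∈ arithProg r a d ↔ ∃ i < r, a + i * d = v := by
  simp [arithProg]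

lemma isArithProg_iff {r : ℕ} {e : Finset ℕ} :
    IsArithProg r e ↔ ∃ a d, 0 < d ∧ e = arithProg r a d := Iff.rfl

lemma card_arithProg (r a : ℕ) {d : ℕ} (hd : 0 < d) : (arithProg r a d).card = r := by
  rw [arithProg, Finset.card_image_of_injective, Finset.card_range]
  intro i j h
  exact Nat.eq_of_mul_eq_mul_right hd (Nat.add_left_cancel h)

lemma arithProg_subset_Icc_iff {r a d n : ℕ} (hr : 0 < r) :
    arithProg r a d ⊆ Finset.Icc 1 n ↔ 1 ≤ a ∧ a + (r - 1) * d ≤ n := by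
  constructor
  · intro h
    have h0 := Finset.mem_Icc.1 (h (mem_arithProg.2 ⟨0, hr, rfl⟩))
    have h1 := Finset.mem_Icc.1 (h (mem_arithProg.2 ⟨r - 1, by omega, rfl⟩))
    exact ⟨by omega, h1.2⟩
  · rintro ⟨ha, hn⟩ v hv
    obtain ⟨i, hi, rfl⟩ := mem_arithProg.1 hv
    have := Nat.mul_le_mul_right d (show i ≤ r - 1 by omega)
    exact Finset.mem_Icc.2 ⟨by omega, by omega⟩

/-- The least and greatest elements, `a` and `a + (r - 1) * d`, recover both parameters. -/
lemma arithProg_injective {r a d a' d' : ℕ} (hr : 2 ≤ r)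
    (h : arithProg r a d = arithProg r a' d') : a = a' ∧ d = d' := by
  have key : ∀ {a d a' d' : ℕ}, arithProg r a d = arithProg r a' d' →
      a' ≤ a ∧ a + (r - 1) * d ≤ a' + (r - 1) * d' := by
    intro a d a' d' h
    constructor
    · obtain ⟨i, -, hi⟩ := mem_arithProg.1 (h ▸ mem_arithProg.2 ⟨0, by omega, rfl⟩ :
        a + 0 * d ∈ arithProg r a' d')
      omega
    · obtain ⟨i, hi, hi'⟩ := mem_arithProg.1 (h ▸ mem_arithProg.2 ⟨r - 1, by omega, rfl⟩ :
        a + (r - 1) * d ∈ arithProg r a' d')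
      have := Nat.mul_le_mul_right d' (show i ≤ r - 1 by omega)
      omega
  have h1 := key h
  have h2 := key h.symm
  refine ⟨by omega, Nat.eq_of_mul_eq_mul_left (show 0 < r - 1 by omega) (by omega)⟩

lemma mem_apHyperedges {r : ℕ} {A e : Finset ℕ} :
    e ∈ apHyperedges r A ↔ e ⊆ A ∧ IsArithProg r e := by
  simp [apHyperedges]

lemma card_of_mem_apHyperedges {r : ℕ} {A e : Finset ℕ} (he : e ∈ apHyperedges r A) :
    e.card = r := by
  obtain ⟨a, d, hd, rfl⟩ := isArithProg_iff.1 (mem_apHyperedges.1 he).2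
  exact card_arithProg r a hd

/-- For a fixed difference `d`, the first term ranges over `1, …, n - (r - 1) * d`. -/
lemma card_apHyperedges_eq_sum {r : ℕ} (hr : 2 ≤ r) (n : ℕ) :
    (apHyperedges r (Finset.Icc 1 n)).card
      = ∑ d ∈ Finset.Icc 1 (n / (r - 1)), (n - (r - 1) * d) := by
  have h : (apHyperedges r (Finset.Icc 1 n)) = ((Finset.Icc 1 (n / (r - 1))).sigma
      fun d => Finset.Icc 1 (n - (r - 1) * d)).image fun x => arithProg r x.2 x.1 := by
    ext e
    rw [mem_apHyperedges, isArithProg_iff, Finset.mem_image]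
    constructor
    · rintro ⟨hs, a, d, hd, rfl⟩
      rw [arithProg_subset_Icc_iff (by omega)] at hs
      refine ⟨⟨d, a⟩, ?_, rfl⟩
      simp only [Finset.mem_sigma, Finset.mem_Icc]
      refine ⟨⟨hd, ?_⟩, by omega, by omega⟩
      rw [Nat.le_div_iff_mul_le (by omega), mul_comm]
      omega
    · rintro ⟨⟨d, a⟩, hx, rfl⟩
      simp only [Finset.mem_sigma, Finset.mem_Icc] at hx
      exact ⟨(arithProg_subset_Icc_iff (by omega)).2 ⟨hx.2.1, by dsimp only; omega⟩, a, d, hx.1.1, rfl⟩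
  rw [h, Finset.card_image_of_injective, Finset.card_sigma]
  · simp
  · rintro ⟨d, a⟩ ⟨d', a'⟩ h
    obtain ⟨rfl, rfl⟩ := arithProg_injective hr h
    rfl

lemma cast_card_apHyperedges {r : ℕ} (hr : 2 ≤ r) (n : ℕ) :
    ((apHyperedges r (Finset.Icc 1 n)).card : ℝ)
      = n * (n / (r - 1) : ℕ) - (r - 1) * ((n / (r - 1) : ℕ) * ((n / (r - 1) : ℕ) + 1) / 2) := by
  rw [card_apHyperedges_eq_sum hr]
  -- The bound on `q` keeps every natural subtraction exact.
  have h : ∀ q : ℕ, (r - 1) * q ≤ n → ((∑ d ∈ Finset.Icc 1 q, (n - (r - 1) * d) : ℕ) : ℝ)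
      = n * q - (r - 1) * (q * (q + 1) / 2) := by
    intro q
    induction q with
    | zero => simp
    | succ q ih =>
      intro hq
      have hle : (r - 1) * q ≤ n := (Nat.mul_le_mul_left _ q.le_succ).trans hq
      rw [Finset.sum_Icc_succ_top (by omega), Nat.cast_add, ih hle, Nat.cast_sub hq]
      push_cast [Nat.cast_sub (show 1 ≤ r by omega)]
      ring
  exact h _ (Nat.mul_div_le n (r - 1))

/-- The number of `r`-term progressions in `[n]` is asymptotically `n ^ 2 / (2 (r - 1))`. -/
lemma tendsto_card_apHyperedges_div_sq {r : ℕ} (hr : 2 ≤ r) :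
    Tendsto (fun n : ℕ => ((apHyperedges r (Finset.Icc 1 n)).card : ℝ) / (n : ℝ) ^ 2) atTop
      (𝓝 (1 / (2 * ((r : ℝ) - 1)))) := by
  have hm : (0 : ℝ) < (r : ℝ) - 1 := by
    have : (2 : ℝ) ≤ r := by exact_mod_cast hr
    linarith
  have hq : Tendsto (fun n : ℕ => ((n / (r - 1) : ℕ) : ℝ) / n) atTop (𝓝 (1 / ((r : ℝ) - 1))) := by
    have h := (tendsto_nat_floor_mul_div_atTop (R := ℝ)
      (a := 1 / ((r : ℝ) - 1)) (by positivity)).comp tendsto_natCast_atTop_atTop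
    refine h.congr fun n => ?_
    simp only [Function.comp]
    rw [one_div_mul_eq_div, ← Nat.cast_pred (by omega : 0 < r), Nat.floor_div_eq_div]
  have hn : Tendsto (fun n : ℕ => 1 / (n : ℝ)) atTop (𝓝 0) := tendsto_one_div_atTop_nhds_zero_nat
  have hlim := hq.sub (((hq.mul (hq.add hn)).div_const 2).const_mul ((r : ℝ) - 1))
  have hval : 1 / ((r : ℝ) - 1) - (r - 1) * (1 / ((r : ℝ) - 1) * (1 / ((r : ℝ) - 1) + 0) / 2)
      = 1 / (2 * ((r : ℝ) - 1)) := by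
    field_simp
    ring
  rw [hval] at hlim
  refine hlim.congr' ?_
  filter_upwards [eventually_gt_atTop 0] with n hn0
  have : (n : ℝ) ≠ 0 := by positivity
  rw [cast_card_apHyperedges hr]
  field_simp

open Classical in
-- A progression through `v` is fixed by the position of `v` in it and by its difference, which is
-- at most `n`.
lemma card_apHyperedges_filter_mem_le {r : ℕ} (hr : 2 ≤ r) (n v : ℕ) :
    ((apHyperedges r (Finset.Icc 1 n)).filter fun f => v ∈ f).card ≤ r * n := by
  have hsub : ((apHyperedges r (Finset.Icc 1 n)).filter fun f => v ∈ f) ⊆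
      (Finset.range r ×ˢ Finset.Icc 1 n).image fun x => arithProg r (v - x.1 * x.2) x.2 := by
    intro f hf
    obtain ⟨hf, hv⟩ := Finset.mem_filter.1 hf
    obtain ⟨hs, a, d, hd, rfl⟩ := mem_apHyperedges.1 hf
    obtain ⟨i, hi, rfl⟩ := mem_arithProg.1 hv
    have h := (arithProg_subset_Icc_iff (by omega)).1 hs
    have := Nat.mul_le_mul_right d (show 1 ≤ r - 1 by omega)
    refine Finset.mem_image.2 ⟨(i, d), ?_, by simp [arithProg]⟩
    simp only [Finset.mem_product, Finset.mem_range, Finset.mem_Icc]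
    omega
  refine (Finset.card_le_card hsub).trans (Finset.card_image_le.trans ?_)
  simp

open Classical in
-- The positions `i ≠ j` of `u` and `v` determine the progression, since `(i - j) * d = u - v`.
lemma card_apHyperedges_filter_mem_mem_le {r u v : ℕ} (huv : u ≠ v) (A : Finset ℕ) :
    ((apHyperedges r A).filter fun f => u ∈ f ∧ v ∈ f).card ≤ r * r := by
  have h := Finset.card_le_card_of_forall_subsingleton
    (s := (apHyperedges r A).filter fun f => u ∈ f ∧ v ∈ f)
    (t := Finset.range r ×ˢ Finset.range r)
    (fun f x => ∃ a d, f = arithProg r a d ∧ a + x.1 * d = u ∧ a + x.2 * d = v) ?_ ?_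
  · simpa using h
  · intro f hf
    obtain ⟨hf, hu, hv⟩ := Finset.mem_filter.1 hf
    obtain ⟨-, a, d, -, rfl⟩ := mem_apHyperedges.1 hf
    obtain ⟨i, hi, rfl⟩ := mem_arithProg.1 hu
    obtain ⟨j, hj, rfl⟩ := mem_arithProg.1 hv
    exact ⟨(i, j), by simp [hi, hj], a, d, rfl, rfl, rfl⟩
  · rintro ⟨i, j⟩ - f ⟨-, a, d, rfl, hi, hj⟩ f' ⟨-, a', d', rfl, hi', hj'⟩
    dsimp only at hi hj hi' hj'
    have hij : (i : ℤ) - j ≠ 0 := by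
      intro h
      have : i = j := by omega
      subst this
      exact huv (hi.symm.trans hj)
    have hd : d = d' := by
      zify at hi hj hi' hj' ⊢
      exact mul_left_cancel₀ hij (by linear_combination hi - hj - hi' + hj')
    subst hd
    have : a = a' := by omega
    rw [this]

open Classical in
/-- A progression meets at most `r * (r * n)` progressions in `[n]`. -/
lemma card_apHyperedges_filter_not_disjoint_le {r : ℕ} (hr : 2 ≤ r) (n : ℕ) {e : Finset ℕ}
    (he : e.card = r) :
    ((apHyperedges r (Finset.Icc 1 n)).filter fun f => ¬Disjoint e f).card ≤ r * (r * n) := by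
  have hsub : ((apHyperedges r (Finset.Icc 1 n)).filter fun f => ¬Disjoint e f) ⊆
      e.biUnion fun v => (apHyperedges r (Finset.Icc 1 n)).filter fun f => v ∈ f := by
    intro f hf
    obtain ⟨hf, hd⟩ := Finset.mem_filter.1 hf
    obtain ⟨v, hv, hv'⟩ := Finset.not_disjoint_iff.1 hd
    exact Finset.mem_biUnion.2 ⟨v, hv, Finset.mem_filter.2 ⟨hf, hv'⟩⟩
  calc _ ≤ _ := Finset.card_le_card hsub
    _ ≤ _ := Finset.card_biUnion_le_card_mul _ _ _ fun v _ =>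
      card_apHyperedges_filter_mem_le hr n v
    _ = _ := by rw [he]

open Classical in
/-- At most `r ^ 4` progressions share two or more elements with a given one. -/
lemma card_apHyperedges_filter_two_le_card_inter_le {r : ℕ} (A : Finset ℕ) {e : Finset ℕ}
    (he : e.card = r) :
    ((apHyperedges r A).filter fun f => 2 ≤ (e ∩ f).card).card ≤ r ^ 4 := by
  have hsub : ((apHyperedges r A).filter fun f => 2 ≤ (e ∩ f).card) ⊆
      e.offDiag.biUnion fun x => (apHyperedges r A).filter fun f => x.1 ∈ f ∧ x.2 ∈ f := by
    intro f hf
    obtain ⟨hf, hc⟩ := Finset.mem_filter.1 hf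
    obtain ⟨u, hu, v, hv, huv⟩ := Finset.one_lt_card.1 hc
    rw [Finset.mem_inter] at hu hv
    exact Finset.mem_biUnion.2 ⟨(u, v), Finset.mem_offDiag.2 ⟨hu.1, hv.1, huv⟩,
      Finset.mem_filter.2 ⟨hf, hu.2, hv.2⟩⟩
  calc _ ≤ _ := Finset.card_le_card hsub
    _ ≤ _ := Finset.card_biUnion_le_card_mul _ _ _ fun x hx =>
      card_apHyperedges_filter_mem_mem_le (Finset.mem_offDiag.1 hx).2.2 A
    _ ≤ (r * r) * (r * r) := by
      refine Nat.mul_le_mul_right _ ?_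
      rw [Finset.offDiag_card, he]
      exact Nat.sub_le _ _
    _ = r ^ 4 := by ring

/-! ### Independence and probabilities for uniform colorings -/

/-- Extension by zero of a coloring of a finite set `S` of elements of `A`. -/
def extendColoring {A : Finset ℕ} (S : Finset A) (y : S → ℕ) (v : ℕ) : ℕ :=
  if h : ∃ hA : v ∈ A, (⟨v, hA⟩ : A) ∈ S then y ⟨⟨v, h.1⟩, h.2⟩ else 0

section Coloring

variable {Ω : Type*} [MeasurableSpace Ω] {P : Measure Ω} {A : Finset ℕ} {c : ℕ} {X : ℕ → Ω → ℕ}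

omit [MeasurableSpace Ω] in
lemma comp_extendColoring_eq {β : Type*} {F : (ℕ → ℕ) → β} {e : Finset ℕ} (he : e ⊆ A)
    (hF : ∀ x y : ℕ → ℕ, (∀ v ∈ e, x v = y v) → F x = F y) (ω : Ω) :
    F (extendColoring (e.subtype (· ∈ A)) fun i => X i ω) = F fun v => X v ω := by
  refine hF _ _ fun v hv => ?_
  have h : ∃ hA : v ∈ A, (⟨v, hA⟩ : A) ∈ e.subtype (· ∈ A) := ⟨he hv, by simpa using hv⟩
  rw [extendColoring, dif_pos h]

/-- `F` factors through the colors on the finite set `A`, which live in a countable discrete space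
where every function is measurable. -/
lemma IsUniformColoring.measurable_comp (hX : IsUniformColoring P A c X) {β : Type*}
    [MeasurableSpace β] {F : (ℕ → ℕ) → β}
    (hF : ∀ x y : ℕ → ℕ, (∀ v ∈ A, x v = y v) → F x = F y) :
    Measurable fun ω => F fun v => X v ω := by
  have h : (fun ω => F fun v => X v ω)
      = (fun y => F (extendColoring (A.subtype (· ∈ A)) y)) ∘ fun ω i => X i ω :=
    funext fun ω => (comp_extendColoring_eq subset_rfl hF ω).symm
  rw [h]
  exact Measurable.of_discrete.comp
    (measurable_pi_lambda _ fun i => hX.measurable i.1 i.1.2)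

lemma IsUniformColoring.indepFun_comp (hX : IsUniformColoring P A c X) {β γ : Type*}
    [MeasurableSpace β] [MeasurableSpace γ] {F : (ℕ → ℕ) → β} {G : (ℕ → ℕ) → γ} {e f : Finset ℕ}
    (he : e ⊆ A) (hf : f ⊆ A) (hd : Disjoint e f)
    (hF : ∀ x y : ℕ → ℕ, (∀ v ∈ e, x v = y v) → F x = F y)
    (hG : ∀ x y : ℕ → ℕ, (∀ v ∈ f, x v = y v) → G x = G y) :
    IndepFun (fun ω => F fun v => X v ω) (fun ω => G fun v => X v ω) P := by
  have hdis : Disjoint (e.subtype (· ∈ A)) (f.subtype (· ∈ A)) := by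
    rw [Finset.disjoint_left] at hd ⊢
    intro i hi hi'
    exact hd (Finset.mem_subtype.1 hi) (Finset.mem_subtype.1 hi')
  have h := (hX.indep.indepFun_finset _ _ hdis fun i => hX.measurable i i.2).comp
    (φ := fun y => F (extendColoring _ y)) (ψ := fun y => G (extendColoring _ y))
    Measurable.of_discrete Measurable.of_discrete
  convert h using 1
  · exact funext fun ω => (comp_extendColoring_eq he hF ω).symm
  · exact funext fun ω => (comp_extendColoring_eq hf hG ω).symm

lemma isMonochromatic_congr {x y : ℕ → ℕ} {e : Finset ℕ} (h : ∀ v ∈ e, x v = y v) :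
    IsMonochromatic x e ↔ IsMonochromatic y e := by
  refine forall₂_congr fun v hv => forall₂_congr fun w hw => ?_
  rw [h v hv, h w hw]

lemma IsMonochromatic.union {x : ℕ → ℕ} {e f : Finset ℕ} (he : IsMonochromatic x e)
    (hf : IsMonochromatic x f) (hef : ¬Disjoint e f) : IsMonochromatic x (e ∪ f) := by
  obtain ⟨u, hu, hu'⟩ := Finset.not_disjoint_iff.1 hef
  have h : ∀ v ∈ e ∪ f, x v = x u := fun v hv =>
    (Finset.mem_union.1 hv).elim (fun hv => he v hv u hu) fun hv => hf v hv u hu'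
  exact fun v hv w hw => (h v hv).trans (h w hw).symm

lemma IsUniformColoring.measurableSet_isMonochromatic (hX : IsUniformColoring P A c X)
    {e : Finset ℕ} (he : e ⊆ A) : MeasurableSet {ω | IsMonochromatic (fun v => X v ω) e} :=
  measurableSet_setOfPred.2 <| hX.measurable_comp (F := fun x => IsMonochromatic x e)
    fun _ _ h => propext (isMonochromatic_congr fun v hv => h v (he hv))

lemma IsUniformColoring.measure_eq_on (hX : IsUniformColoring P A c X) {e : Finset ℕ}
    (he : e ⊆ A) {a : ℕ} (ha : a ∈ Finset.Icc 1 c) :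
    P {ω | ∀ v ∈ e, X v ω = a} = (c : ENNReal)⁻¹ ^ e.card := by
  have h := hX.indep.measure_inter_preimage_eq_mul (e.subtype (· ∈ A))
    (sets := fun _ => {a}) fun _ _ => .singleton a
  have hset : {ω | ∀ v ∈ e, X v ω = a}
      = ⋂ i ∈ e.subtype (· ∈ A), (fun ω => X i ω) ⁻¹' {a} := by
    ext ω
    simp only [Set.mem_ofPred_eq, Set.mem_iInter, Finset.mem_subtype, Set.mem_preimage,
      Set.mem_singleton_iff]
    exact ⟨fun h i hi => h i hi, fun h v hv => h ⟨v, he hv⟩ hv⟩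
  have hcard : (e.subtype (· ∈ A)).card = e.card := by
    rw [Finset.card_subtype, Finset.filter_true_of_mem fun v hv => he hv]
  rw [hset]
  refine h.trans ?_
  rw [Finset.prod_congr rfl fun (i : A) _ => show P (X i ⁻¹' {a}) = (c : ENNReal)⁻¹ from
    hX.uniform i i.2 a ha, Finset.prod_const, hcard]

/-- The `c` colors have mass `1 / c` each, which leaves no mass for other values. -/
lemma IsUniformColoring.ae_mem_Icc [IsProbabilityMeasure P] (hX : IsUniformColoring P A c X)
    (hc : 0 < c) {v : ℕ} (hv : v ∈ A) : ∀ᵐ ω ∂P, X v ω ∈ Finset.Icc 1 c := by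
  have hm : MeasurableSet {ω | X v ω ∈ Finset.Icc 1 c} :=
    hX.measurable v hv (Finset.measurableSet (Finset.Icc 1 c))
  refine (mem_ae_iff_prob_eq_one hm).2 ?_
  have h : {ω | X v ω ∈ Finset.Icc 1 c} = ⋃ a ∈ Finset.Icc 1 c, {ω | X v ω = a} := by
    ext ω
    simp
  have hma : ∀ a, MeasurableSet {ω | X v ω = a} := fun a => hX.measurable v hv (.singleton a)
  rw [h, measure_biUnion_finset ?_ fun a _ => hma a,
    Finset.sum_congr rfl fun a ha => hX.uniform v hv a ha]
  · have : (c : ENNReal) ≠ 0 := by exact_mod_cast hc.ne'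
    simp [ENNReal.mul_inv_cancel this (ENNReal.natCast_ne_top c)]
  · intro a _ b _ hab
    exact Set.disjoint_left.2 fun ω ha hb => hab (ha.symm.trans hb)

/-- The probability that a nonempty set `e` is monochromatic is `c ^ (1 - |e|)`. -/
lemma IsUniformColoring.measureReal_isMonochromatic [IsProbabilityMeasure P]
    (hX : IsUniformColoring P A c X) (hc : 0 < c) {e : Finset ℕ} (he : e ⊆ A) (hne : e.Nonempty) :
    P.real {ω | IsMonochromatic (fun v => X v ω) e} = (c : ℝ)⁻¹ ^ (e.card - 1) := by
  obtain ⟨w, hw⟩ := hne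
  have hae : {ω | IsMonochromatic (fun v => X v ω) e}
      -- Split by the common color, which is almost surely in `{1, …, c}` because the color of `w`
      -- is.
      =ᵐ[P] ⋃ a ∈ Finset.Icc 1 c, {ω | ∀ v ∈ e, X v ω = a} := by
    filter_upwards [hX.ae_mem_Icc hc (he hw)] with ω hω
    refine propext ?_
    change IsMonochromatic (fun v => X v ω) e ↔ ω ∈ ⋃ a ∈ Finset.Icc 1 c, {ω | ∀ v ∈ e, X v ω = a}
    simp only [Set.mem_iUnion, Set.mem_ofPred_eq, exists_prop]
    exact ⟨fun h => ⟨X w ω, hω, fun v hv => h v hv w hw⟩,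
      fun ⟨a, _, ha⟩ v hv v' hv' => (ha v hv).trans (ha v' hv').symm⟩
  have hmeas : ∀ a, MeasurableSet {ω | ∀ v ∈ e, X v ω = a} := fun a =>
    measurableSet_setOfPred.2 <| hX.measurable_comp (F := fun x => ∀ v ∈ e, x v = a)
      fun x y h => propext (forall₂_congr fun v hv => by rw [h v (he hv)])
  have hP : P {ω | IsMonochromatic (fun v => X v ω) e} = c * (c : ENNReal)⁻¹ ^ e.card := by
    rw [measure_congr hae, measure_biUnion_finset ?_ fun a _ => hmeas a,
      Finset.sum_congr rfl fun a ha => hX.measure_eq_on he ha]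
    · simp
    · intro a _ b _ hab
      refine Set.disjoint_left.2 fun ω ha hb => hab ?_
      exact (ha w hw).symm.trans (hb w hw)
  have hcard : e.card = (e.card - 1) + 1 := by
    have := Finset.card_pos.2 ⟨w, hw⟩
    omega
  have hc0 : (c : ℝ) ≠ 0 := by positivity
  rw [measureReal_def, hP, hcard, Nat.add_sub_cancel, ENNReal.toReal_mul, ENNReal.toReal_pow,
    ENNReal.toReal_inv, ENNReal.toReal_natCast, pow_succ]
  field_simp

end Coloring

/-! ### Dependencies between monochromatic progressions -/

section MonochromaticProgressions

variable {Ω : Type*} [MeasurableSpace Ω] {P : Measure Ω} {A : Finset ℕ} {c : ℕ} {X : ℕ → Ω → ℕ}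

/-- The event that `e` is monochromatic under the random coloring `X`. -/
def monochromaticEvent (X : ℕ → Ω → ℕ) (e : Finset ℕ) : Set Ω :=
  {ω | IsMonochromatic (fun v => X v ω) e}

open Classical in
omit [MeasurableSpace Ω] in
lemma indicator_monochromaticEvent (e : Finset ℕ) (ω : Ω) :
    (monochromaticEvent X e).indicator (fun _ => (1 : ℝ)) ω
      = if IsMonochromatic (fun v => X v ω) e then 1 else 0 := by
  by_cases h : IsMonochromatic (fun v => X v ω) e <;> simp [monochromaticEvent, h]

open Classical in
omit [MeasurableSpace Ω] in
lemma eventCount_monochromaticEvent (s : Finset (Finset ℕ)) (ω : Ω) :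
    eventCount s (monochromaticEvent X) ω
      = ∑ e ∈ s, if IsMonochromatic (fun v => X v ω) e then (1 : ℝ) else 0 :=
  Finset.sum_congr rfl fun e _ => indicator_monochromaticEvent e ω

omit [MeasurableSpace Ω] in
lemma eventCount_apHyperedges (r : ℕ) (ω : Ω) :
    eventCount (apHyperedges r A) (monochromaticEvent X) ω
      = monoAPCount r A fun v => X v ω := by
  classical
  rw [eventCount_monochromaticEvent, Finset.sum_boole, monoAPCount]

open Classical in
/-- The progressions in `A` that meet `e`. -/
noncomputable def apNeighbors (r : ℕ) (A e : Finset ℕ) : Finset (Finset ℕ) :=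
  (apHyperedges r A).filter fun f => ¬Disjoint e f

open Classical in
-- Progressions disjoint from `e` only see the colors on `A \ e`.
lemma IsUniformColoring.indepFun_eventCount_sdiff_apNeighbors (hX : IsUniformColoring P A c X)
    {r : ℕ} {e : Finset ℕ} (he : e ⊆ A) :
    IndepFun ((monochromaticEvent X e).indicator fun _ => (1 : ℝ))
      (eventCount (apHyperedges r A \ apNeighbors r A e) (monochromaticEvent X)) P := by
  have h := hX.indepFun_comp he Finset.sdiff_subset Finset.disjoint_sdiff
    (F := fun x => if IsMonochromatic x e then (1 : ℝ) else 0)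
    (G := fun x => ∑ f ∈ apHyperedges r A \ apNeighbors r A e,
      if IsMonochromatic x f then (1 : ℝ) else 0)
    (fun x y hxy => by simp only [isMonochromatic_congr hxy]) ?_
  · convert h using 1
    · exact funext fun ω => indicator_monochromaticEvent e ω
    · exact funext fun ω => eventCount_monochromaticEvent _ ω
  · refine fun x y hxy => Finset.sum_congr rfl fun f hf => ?_
    have hf' : f ⊆ A \ e := by
      rw [Finset.mem_sdiff, apNeighbors, Finset.mem_filter, not_and, not_not] at hf
      exact Finset.subset_sdiff.2 ⟨(mem_apHyperedges.1 hf.1).1, (hf.2 hf.1).symm⟩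
    simp only [isMonochromatic_congr fun v hv => hxy v (hf' hv)]

variable [IsProbabilityMeasure P]

lemma IsUniformColoring.measureReal_monochromaticEvent (hX : IsUniformColoring P A c X)
    (hc : 0 < c) {r : ℕ} (hr : 0 < r) {e : Finset ℕ} (he : e ∈ apHyperedges r A) :
    P.real (monochromaticEvent X e) = (c : ℝ)⁻¹ ^ (r - 1) := by
  have hcard := card_of_mem_apHyperedges he
  rw [monochromaticEvent, hX.measureReal_isMonochromatic hc (mem_apHyperedges.1 he).1
    (Finset.card_pos.1 (by omega)), hcard]

open Classical in
/-- Two distinct intersecting progressions are simultaneously monochromatic with probability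
`c ^ (-2 (r - 1))` if they share one element, and at most `c ^ (-r)` otherwise. -/
lemma IsUniformColoring.measureReal_inter_monochromaticEvent_le (hX : IsUniformColoring P A c X)
    (hc : 0 < c) {r : ℕ} {e f : Finset ℕ} (he : e ∈ apHyperedges r A)
    (hf : f ∈ apHyperedges r A) (hef : f ≠ e) (hd : ¬Disjoint e f) :
    P.real (monochromaticEvent X e ∩ monochromaticEvent X f)
      ≤ (c : ℝ)⁻¹ ^ (2 * (r - 1)) + if 2 ≤ (e ∩ f).card then (c : ℝ)⁻¹ ^ r else 0 := by
  have hce := card_of_mem_apHyperedges he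
  have hcf := card_of_mem_apHyperedges hf
  have hsub : e ∪ f ⊆ A :=
    Finset.union_subset (mem_apHyperedges.1 he).1 (mem_apHyperedges.1 hf).1
  have hinter : 0 < (e ∩ f).card :=
    Finset.card_pos.2 (Finset.nonempty_iff_ne_empty.2 fun h =>
      hd (Finset.disjoint_iff_inter_eq_empty.2 h))
  have hiu := Finset.card_le_card (Finset.inter_subset_union (s := e) (t := f))
  have hcu := Finset.card_union_add_card_inter e f
  have hle : P.real (monochromaticEvent X e ∩ monochromaticEvent X f)
      ≤ (c : ℝ)⁻¹ ^ ((e ∪ f).card - 1) := by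
    rw [← hX.measureReal_isMonochromatic hc hsub (Finset.card_pos.1 (by omega))]
    exact measureReal_mono fun ω hω => IsMonochromatic.union hω.1 hω.2 hd
  have hq0 : (0 : ℝ) ≤ (c : ℝ)⁻¹ := by positivity
  have hq1 : (c : ℝ)⁻¹ ≤ 1 := inv_le_one_of_one_le₀ (by exact_mod_cast hc)
  split_ifs with h2
  -- Distinct sets of size `r` have a union of at least `r + 1` elements, hence the exponent `r`.
  · have hss : (e ∩ f).card < r := by
      refine hce ▸ Finset.card_lt_card (Finset.inter_subset_left.ssubset_of_ne fun h => hef ?_)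
      exact (Finset.eq_of_subset_of_card_le (Finset.inter_eq_left.1 h) (by omega)).symm
    have := hle.trans (pow_le_pow_of_le_one hq0 hq1 (show r ≤ (e ∪ f).card - 1 by omega))
    have : 0 ≤ (c : ℝ)⁻¹ ^ (2 * (r - 1)) := by positivity
    linarith
  · rw [add_zero]
    exact hle.trans (pow_le_pow_of_le_one hq0 hq1 (by omega))

/-- The factor `2` arises because joint probabilities of pairs sharing one point and products of
probabilities obey the same bound. -/
lemma IsUniformColoring.dependencySum_le {n : ℕ} (hX : IsUniformColoring P (Finset.Icc 1 n) c X)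
    (hc : 0 < c) {r : ℕ} (hr : 2 ≤ r) :
    dependencySum P (apHyperedges r (Finset.Icc 1 n)) (apNeighbors r (Finset.Icc 1 n))
        (monochromaticEvent X)
      ≤ (apHyperedges r (Finset.Icc 1 n)).card
        * (2 * r ^ 2 * n * (c : ℝ)⁻¹ ^ (2 * (r - 1)) + r ^ 4 * (c : ℝ)⁻¹ ^ r) := by
  classical
  set q : ℝ := (c : ℝ)⁻¹ with hq
  have hq0 : 0 ≤ q := by positivity
  set S := apHyperedges r (Finset.Icc 1 n) with hS
  rw [dependencySum, ← nsmul_eq_mul]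
  refine Finset.sum_le_card_nsmul _ _ _ fun e he => ?_
  have hNcard : ((apNeighbors r (Finset.Icc 1 n) e).card : ℝ) ≤ r ^ 2 * n := by
    have h := card_apHyperedges_filter_not_disjoint_le hr n (card_of_mem_apHyperedges he)
    calc ((apNeighbors r (Finset.Icc 1 n) e).card : ℝ) ≤ (r * (r * n) : ℕ) := by exact_mod_cast h
      _ = r ^ 2 * n := by push_cast; ring
  have h1 : ∑ f ∈ (apNeighbors r (Finset.Icc 1 n) e).erase e,
      P.real (monochromaticEvent X e ∩ monochromaticEvent X f)
      ≤ r ^ 2 * n * q ^ (2 * (r - 1)) + r ^ 4 * q ^ r := by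
    calc _ ≤ ∑ f ∈ (apNeighbors r (Finset.Icc 1 n) e).erase e,
          (q ^ (2 * (r - 1)) + if 2 ≤ (e ∩ f).card then q ^ r else 0) := by
          refine Finset.sum_le_sum fun f hf => ?_
          obtain ⟨hne, hf⟩ := Finset.mem_erase.1 hf
          obtain ⟨hf, hd⟩ := Finset.mem_filter.1 hf
          exact hX.measureReal_inter_monochromaticEvent_le hc he hf hne hd
      _ ≤ ∑ f ∈ apNeighbors r (Finset.Icc 1 n) e, q ^ (2 * (r - 1))
          + ∑ f ∈ S, if 2 ≤ (e ∩ f).card then q ^ r else 0 := by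
          rw [Finset.sum_add_distrib]
          refine add_le_add (Finset.sum_le_sum_of_subset_of_nonneg (Finset.erase_subset _ _)
            fun _ _ _ => by positivity) (Finset.sum_le_sum_of_subset_of_nonneg
            ((Finset.erase_subset _ _).trans (Finset.filter_subset _ _))
            fun _ _ _ => by positivity)
      _ ≤ _ := by
          rw [Finset.sum_const, nsmul_eq_mul, ← Finset.sum_filter, Finset.sum_const, nsmul_eq_mul]
          refine add_le_add (mul_le_mul_of_nonneg_right hNcard (by positivity))
            (mul_le_mul_of_nonneg_right ?_ (by positivity))
          exact_mod_cast card_apHyperedges_filter_two_le_card_inter_le (Finset.Icc 1 n)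
            (card_of_mem_apHyperedges he)
  have h2 : P.real (monochromaticEvent X e)
      * ∑ f ∈ apNeighbors r (Finset.Icc 1 n) e, P.real (monochromaticEvent X f)
      ≤ r ^ 2 * n * q ^ (2 * (r - 1)) := by
    rw [hX.measureReal_monochromaticEvent hc (by omega) he, Finset.sum_congr rfl fun f
      (hf : f ∈ apNeighbors r (Finset.Icc 1 n) e) => hX.measureReal_monochromaticEvent hc (by omega)
        (Finset.mem_of_mem_filter f hf), Finset.sum_const, nsmul_eq_mul]
    calc _ = (apNeighbors r (Finset.Icc 1 n) e).card * q ^ (2 * (r - 1)) := by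
          rw [two_mul, pow_add]; ring
      _ ≤ _ := mul_le_mul_of_nonneg_right hNcard (by positivity)
  calc _ ≤ _ := add_le_add h1 h2
    _ = _ := by ring

end MonochromaticProgressions

/-! ### Asymptotics and conclusion -/

theorem corollary1p9 (r : ℕ) (hr : 3 ≤ r) (lam : ℝ) (hlam : 0 < lam)
    (c : ℕ → ℕ) (hc_pos : ∀ n, 0 < c n)
    (hc : Tendsto (fun n : ℕ => (c n : ℝ) / (n : ℝ) ^ ((2 : ℝ) / ((r : ℝ) - 1))) atTop (𝓝 lam))
    {Ω : ℕ → Type*} [∀ n, MeasurableSpace (Ω n)]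
    (P : ∀ n, Measure (Ω n)) [∀ n, IsProbabilityMeasure (P n)]
    (X : ∀ n, ℕ → Ω n → ℕ)
    (hX : ∀ n, IsUniformColoring (P n) (Finset.Icc 1 n) (c n) (X n)) :
    TendstoInDistribution
      (fun n ω => (monoAPCount r (Finset.Icc 1 n) (fun v => X n v ω) : ℝ)) atTop
      (fun k : ℕ => (k : ℝ)) P
      (poissonMeasure (Real.toNNReal (1 / (2 * ((r : ℝ) - 1) * lam ^ (r - 1))))) := by
  have hr1 : (0 : ℝ) < (r : ℝ) - 1 := by
    have : (3 : ℝ) ≤ r := by exact_mod_cast hr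
    linarith
  have hK := tendsto_card_apHyperedges_div_sq (r := r) (by omega)
  have hx : Tendsto (fun n : ℕ => (n : ℝ) ^ 2 * (c n : ℝ)⁻¹ ^ (r - 1)) atTop
      (𝓝 (lam ^ (r - 1))⁻¹) := by
    refine ((hc.pow (r - 1)).inv₀ (by positivity)).congr fun n => ?_
    have h : ((n : ℝ) ^ ((2 : ℝ) / ((r : ℝ) - 1))) ^ (r - 1) = (n : ℝ) ^ 2 := by
      rw [← Real.rpow_mul_natCast n.cast_nonneg, Nat.cast_pred (by omega),
        div_mul_cancel₀ _ hr1.ne', Real.rpow_two]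
    rw [div_pow, h, inv_div, inv_pow, div_eq_mul_inv]
  have hq : Tendsto (fun n : ℕ => (c n : ℝ)⁻¹) atTop (𝓝 0) := by
    have h := (hc.inv₀ hlam.ne').mul (tendsto_inv_atTop_zero.comp
      ((tendsto_rpow_atTop (y := (2 : ℝ) / ((r : ℝ) - 1)) (by positivity)).comp
        tendsto_natCast_atTop_atTop))
    rw [mul_zero] at h
    refine h.congr' ?_
    filter_upwards [eventually_gt_atTop 0] with n hn
    have : (0 : ℝ) < (n : ℝ) ^ ((2 : ℝ) / ((r : ℝ) - 1)) := by positivity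
    simp only [Function.comp]
    field_simp
  have hmean : Tendsto (fun n => ∑ e ∈ apHyperedges r (Finset.Icc 1 n),
      (P n).real (monochromaticEvent (X n) e)) atTop
      (𝓝 (1 / (2 * ((r : ℝ) - 1) * lam ^ (r - 1)))) := by
    have h := hK.mul hx
    rw [show 1 / (2 * ((r : ℝ) - 1)) * (lam ^ (r - 1))⁻¹
      = 1 / (2 * ((r : ℝ) - 1) * lam ^ (r - 1)) by rw [one_div, one_div, ← mul_inv]] at h
    refine h.congr' ?_
    filter_upwards [eventually_gt_atTop 0] with n hn
    have hn' : (n : ℝ) ≠ 0 := by positivity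
    rw [Finset.sum_congr rfl fun e he =>
      (hX n).measureReal_monochromaticEvent (hc_pos n) (by omega) he, Finset.sum_const,
      nsmul_eq_mul]
    field_simp
  have hdep : Tendsto (fun n => dependencySum (P n) (apHyperedges r (Finset.Icc 1 n))
      (apNeighbors r (Finset.Icc 1 n)) (monochromaticEvent (X n))) atTop (𝓝 0) := by
    have hn : Tendsto (fun n : ℕ => 1 / (n : ℝ)) atTop (𝓝 0) := tendsto_one_div_atTop_nhds_zero_nat
    -- With `x = n ^ 2 * c ^ (1 - r)`, the bound is (number of progressions) `/ n ^ 2` times `2 r ^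
    -- 2 x ^ 2 / n + r ^ 4 x / c`.
    have h := hK.mul ((((hx.pow 2).mul hn).const_mul (2 * (r : ℝ) ^ 2)).add
      ((hx.mul hq).const_mul ((r : ℝ) ^ 4)))
    simp only [mul_zero, add_zero] at h
    refine squeeze_zero' (Eventually.of_forall fun n => dependencySum_nonneg _ _ _) ?_ h
    filter_upwards [eventually_gt_atTop 0] with n hn0
    have hn' : (n : ℝ) ≠ 0 := by positivity
    refine ((hX n).dependencySum_le (hc_pos n) (by omega)).trans_eq ?_
    have hpow : (c n : ℝ)⁻¹ ^ r = (c n : ℝ)⁻¹ ^ (r - 1) * (c n : ℝ)⁻¹ := by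
      rw [← pow_succ, Nat.sub_add_cancel (by omega)]
    rw [hpow, mul_comm 2 (r - 1), pow_mul]
    generalize (c n : ℝ)⁻¹ ^ (r - 1) = y
    field_simp
  have h := tendstoInDistribution_poisson_of_dependencySum (P := P)
    (s := fun n => apHyperedges r (Finset.Icc 1 n)) (N := fun n => apNeighbors r (Finset.Icc 1 n))
    (E := fun n => monochromaticEvent (X n))
    (fun n e he => (hX n).measurableSet_isMonochromatic (mem_apHyperedges.1 he).1)
    (fun n e _ => Finset.filter_subset _ _)
    (fun n e he => ?_)
    (fun n e he => (hX n).indepFun_eventCount_sdiff_apNeighbors (mem_apHyperedges.1 he).1)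
    (by positivity) hmean hdep
  · have hcount : (fun n ω => (monoAPCount r (Finset.Icc 1 n) (fun v => X n v ω) : ℝ))
        = fun n => eventCount (apHyperedges r (Finset.Icc 1 n)) (monochromaticEvent (X n)) :=
      funext fun n => funext fun ω => (eventCount_apHyperedges r ω).symm
    rw [hcount]
    exact h
  -- A progression is its own neighbor because it is nonempty.
  · refine Finset.mem_filter.2 ⟨he, fun hd => ?_⟩
    have hcard := card_of_mem_apHyperedges he
    rw [disjoint_self.1 hd] at hcard
    simp at hcard
    omega
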